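/- Graphs are finite and simple. For a graph $\Gamma$ with vertex set $V$, the right-angled Coxeter group (RACG) based on $\Gamma$ is $G(\Gamma)=\langle s\in V \mid s^2=1 \text{ for } s\in V,\ (ss')^2=1 \text{ for every edge } \{s,s'\}\rangle$. Its geodesic growth series is $\sum_{m\ge 0} f(m)t^m$, where $f(m)$ is the number of words of length $m$ over $V$ that are geodesic, i.e. whose length equals the word length (with respect to $V$) of the element of $G(\Gamma)$ they represent. Two graphs are co-spectral if their adjacency matrices have the same characteristic polynomial. The coalescence $\tau\cdot\sigma$ of two rooted trees is the tree obtained from their disjoint union by identifying the two roots. Let $S_1$ and $S_2$ be Godsil's trees on the vertex set $\{0,1,\dots,10\}$, rooted at $0$, where $S_1$ has the edges $01, 02, 13, 24, 25, 36, \{5,10\}, \{10,7\}, 78, 79$ and $S_2$ has the edges $\{0,10\}, \{10,1\}, 02, 13, 14, 25, 26, 37, 78, 89$. **Theorem.** Let $n\ge 12$. For every rooted tree $\tau$ on $n-10$ vertices, with any choice of root, $\Gamma_1=\tau\cdot S_1$ and $\Gamma_2=\tau\cdot S_2$ are trees on $n$ vertices such that 1. $\Gamma_1$ and $\Gamma_2$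 are not isomorphic, but are co-spectral and have co-spectral complements; and 2. the RACGs $G(\Gamma_1)$ and $G(\Gamma_2)$ have distinct geodesic growth series. In particular, for every $n\ge 12$ there are two non-isomorphic co-spectral trees on $n$ vertices with co-spectral complements whose RACGs have distinct geodesic growth series; so the spectrum of a tree does not determine the geodesic growth of its RACG. -/

import Mathlib

/-- The coalescence of the rooted graphs `(G, r)` and `(H, s)`: their disjoint union with the
roots `r` and `s` identified (the root `s` of `H` is represented by `r`). -/
def coalescence {V W : Type*} (G : SimpleGraph V) (r : V) (H : SimpleGraph W) (s : W) :
    SimpleGraph (V ⊕ {w : W // w ≠ s}) where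
  Adj
    | .inl a, .inl b => G.Adj a b
    | .inr a, .inr b => H.Adj a b
    | .inl a, .inr b => a = r ∧ H.Adj s b
    | .inr a, .inl b => b = r ∧ H.Adj s a
  symm := ⟨by
    rintro (a | a) (b | b) h
    · exact SimpleGraph.Adj.symm h
    · exact h
    · exact h
    · exact SimpleGraph.Adj.symm h⟩
  loopless := ⟨by
    rintro (a | a) h
    · exact G.irrefl h
    · exact H.irrefl h⟩

/-- Godsil's first tree; its root is the vertex `0`. -/
def godsilS₁ : SimpleGraph (Fin 11) :=
  SimpleGraph.fromEdgeSet
    {s(0, 1), s(0, 2), s(1, 3), s(2, 4), s(2, 5), s(3, 6), s(5, 10), s(10, 7), s(7, 8), s(7, 9)}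

/-- Godsil's second tree; its root is the vertex `0`. -/
def godsilS₂ : SimpleGraph (Fin 11) :=
  SimpleGraph.fromEdgeSet
    {s(0, 10), s(10, 1), s(0, 2), s(1, 3), s(1, 4), s(2, 5), s(2, 6), s(3, 7), s(7, 8), s(8, 9)}

open Classical in
/-- Two finite graphs are co-spectral if their adjacency matrices have the same characteristic
polynomial. -/
def Cospectral {V W : Type*} [Fintype V] [Fintype W] (G : SimpleGraph V) (H : SimpleGraph W) :
    Prop :=
  (G.adjMatrix ℤ).charpoly = (H.adjMatrix ℤ).charpoly

open Classical in
/-- The Coxeter matrix of the right-angled Coxeter group based on `G`: distinct generators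
commute exactly when they are adjacent; the entry `0` means that there is no relation. -/
noncomputable def racgMatrix {V : Type*} (G : SimpleGraph V) : CoxeterMatrix V where
  M := Matrix.of fun a b => if a = b then 1 else if G.Adj a b then 2 else 0
  isSymm := by
    ext a b
    simp [eq_comm, G.adj_comm]
  diagonal := by simp
  off_diagonal := by
    intro a b h
    simp only [Matrix.of_apply, if_neg h]
    split_ifs <;> decide

/-- The right-angled Coxeter group based on `G`, that is
`⟨s ∈ V ∣ s² = 1, (s s')² = 1 for all edges {s, s'}⟩`. -/
abbrev RACG {V : Type*} (G : SimpleGraph V) : Type _ := (racgMatrix G).Group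

/-- The standard generating set `V` of the right-angled Coxeter group based on `G`. -/
noncomputable def racgSystem {V : Type*} (G : SimpleGraph V) : CoxeterSystem (racgMatrix G) (RACG G) :=
  (racgMatrix G).toCoxeterSystem

/-- A word in the vertices of `G` is geodesic in the right-angled Coxeter group based on `G` if
its length equals the word length of the group element it represents. -/
def IsGeodesicWord {V : Type*} (G : SimpleGraph V) (w : List V) : Prop :=
  (racgSystem G).length ((racgSystem G).wordProd w) = w.length

/-- The number of geodesic words of length `m` in the right-angled Coxeter group based on `G`. -/
noncomputable def geodesicGrowth {V : Type*} (G : SimpleGraph V) (m : ℕ) : ℕ :=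
  Set.ncard {w : List V | w.length = m ∧ IsGeodesicWord G w}

/-- The geodesic growth series of the right-angled Coxeter group based on `G`. -/
noncomputable def geodesicGrowthSeries {V : Type*} (G : SimpleGraph V) : PowerSeries ℕ :=
  PowerSeries.mk (geodesicGrowth G)

/-!
Let `A` and `D` be the adjacency and degree matrices of a triangle-free graph. Its geodesic growth
series is the reciprocal of `1 - |V| X + X² (1 + 2X) S`, where `S` is the sum of the entries of the
inverse of `(1 + X)(1 + 2X) - X(1 + X) D + X² A`. Indeed, the commuting leading letters of a
geodesic word form a clique, so the numbers of its geodesic extensions depend on a vertex, an edge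
or nothing, and the edge terms can be eliminated.

Outside the diagonal term `(1 + X)(1 + 2X)` this matrix is additive under coalescence, so `τ` acts
on the rest of `τ · H` only through a source `μ = X (deg r + ⋯)` at the root. Let `t` be the root
entry of the solution for `H` with right-hand side `1`, and `g` the diagonal entry of the inverse at
the root. Then the values of `S` on `τ · H` and `τ · H'` differ by
`(S - S') + (μ + μ') (t - t') + μ μ' (g - g')`. For Godsil's trees the three differences vanish to
orders `8`, `6` and `6`, and `t - t'` has leading term `-X⁶`, so the coefficient of `X⁷` is
`-2 deg r ≠ 0`.

The spectra agree because the adjacency matrices of Godsil's trees are conjugated by an orthogonal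
matrix that fixes the all-one vector and the root, and such a matrix extends by the identity to
every coalescence.
-/

section Words

variable {V : Type*} {G : SimpleGraph V}

/-- The letter `s` occurs in the word and its first occurrence is preceded only by letters
adjacent to `s`, so that commutations bring it to the front. -/
def MovesToFront (G : SimpleGraph V) (s : V) : List V → Prop
  | [] => False
  | c :: w => s = c ∨ (G.Adj s c ∧ MovesToFront G s w)

/-- No two equal letters of the word can be brought next to each other by commutations. -/
def IsTraceReduced (G : SimpleGraph V) : List V → Prop
  | [] => True
  | c :: w => ¬MovesToFront G c w ∧ IsTraceReduced G w

/-- Equality in the trace monoid of `G`: two words are equivalent if they differ by exchanges of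
consecutive letters that are adjacent in `G`. The constructors mirror those of `List.Perm`. -/
inductive TraceEquiv (G : SimpleGraph V) : List V → List V → Prop
  | nil : TraceEquiv G [] []
  | cons (s : V) {u v : List V} : TraceEquiv G u v → TraceEquiv G (s :: u) (s :: v)
  | swap {s t : V} (h : G.Adj s t) (w : List V) : TraceEquiv G (s :: t :: w) (t :: s :: w)
  | trans {u v w : List V} : TraceEquiv G u v → TraceEquiv G v w → TraceEquiv G u w

namespace TraceEquiv

variable {u v : List V}

theorem refl : ∀ w : List V, TraceEquiv G w w
  | [] => nil
  | s :: w => cons s (refl w)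

theorem symm (h : TraceEquiv G u v) : TraceEquiv G v u := by
  induction h with
  | nil => exact nil
  | cons s _ ih => exact cons s ih
  | swap h w => exact swap h.symm w
  | trans _ _ ih₁ ih₂ => exact ih₂.trans ih₁

theorem perm (h : TraceEquiv G u v) : u.Perm v := by
  induction h with
  | nil => exact .nil
  | cons s _ ih => exact ih.cons s
  | swap _ w => exact .swap _ _ w
  | trans _ _ ih₁ ih₂ => exact ih₁.trans ih₂

theorem erase [DecidableEq V] (h : TraceEquiv G u v) (s : V) :
    TraceEquiv G (u.erase s) (v.erase s) := by
  induction h with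
  | nil => exact nil
  | cons c h ih =>
    by_cases hc : c = s
    · simpa [hc] using h
    · simpa [List.erase_cons, hc] using cons c ih
  | @swap a b h w =>
    have hab := h.ne
    by_cases ha : a = s <;> by_cases hb : b = s
    · exact absurd (ha.trans hb.symm) hab
    · simpa [ha, hb] using refl (b :: w)
    · simpa [ha, hb] using refl (a :: w)
    · simpa [ha, hb] using swap h (w.erase s)
  | trans _ _ ih₁ ih₂ => exact ih₁.trans ih₂

theorem movesToFront_iff (h : TraceEquiv G u v) (s : V) :
    MovesToFront G s u ↔ MovesToFront G s v := by
  induction h with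
  | nil => rfl
  | cons c _ ih => simp only [MovesToFront, ih]
  | @swap a b h w =>
    have := h.symm
    simp only [MovesToFront]
    constructor <;> rintro (rfl | ⟨h', rfl | h''⟩) <;> tauto
  | trans _ _ ih₁ ih₂ => exact ih₁.trans ih₂

theorem isTraceReduced_iff (h : TraceEquiv G u v) : IsTraceReduced G u ↔ IsTraceReduced G v := by
  induction h with
  | nil => rfl
  | cons c h ih => simp only [IsTraceReduced, ih, h.movesToFront_iff]
  | @swap a b h w =>
    simp only [IsTraceReduced, MovesToFront, h, h.symm, h.ne, h.ne', false_or, true_and]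
    tauto
  | trans _ _ ih₁ ih₂ => exact ih₁.trans ih₂

end TraceEquiv

theorem MovesToFront.traceEquiv_cons_erase [DecidableEq V] {s : V} {w : List V}
    (h : MovesToFront G s w) : TraceEquiv G w (s :: w.erase s) := by
  induction w with
  | nil => exact h.elim
  | cons c w ih =>
    by_cases hc : c = s
    · simpa [hc] using TraceEquiv.refl (s :: w)
    · obtain ⟨hadj, h⟩ := h.resolve_left (Ne.symm hc)
      rw [List.erase_cons_tail (by simpa using hc)]
      exact ((ih h).cons c).trans (.swap hadj.symm _)

theorem movesToFront_cons_iff_of_adj {s t : V} (h : G.Adj s t) {w : List V} :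
    MovesToFront G s (t :: w) ↔ MovesToFront G s w := by
  simp [MovesToFront, h, h.ne]

theorem MovesToFront.erase_iff_of_adj [DecidableEq V] {s t : V} {w : List V}
    (ht : MovesToFront G t w) (h : G.Adj s t) :
    MovesToFront G s (w.erase t) ↔ MovesToFront G s w := by
  rw [ht.traceEquiv_cons_erase.movesToFront_iff, movesToFront_cons_iff_of_adj h]

theorem IsTraceReduced.of_append {u w : List V} (h : IsTraceReduced G (u ++ w)) :
    IsTraceReduced G w := by
  induction u with
  | nil => exact h
  | cons c u ih => exact ih h.2

open Classical in
/-- Left multiplication of a reduced word by a generator: the generator cancels if it can be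
brought to the front, and is prepended otherwise. -/
noncomputable def genStep (G : SimpleGraph V) (s : V) (w : List V) : List V :=
  if MovesToFront G s w then w.erase s else s :: w

theorem genStep_of_movesToFront [DecidableEq V] {s : V} {w : List V} (h : MovesToFront G s w) :
    genStep G s w = w.erase s := by
  rw [genStep, if_pos h]
  congr!

theorem genStep_of_not_movesToFront {s : V} {w : List V} (h : ¬MovesToFront G s w) :
    genStep G s w = s :: w :=
  if_neg h

theorem IsTraceReduced.genStep_isTraceReduced {w : List V} (hw : IsTraceReduced G w) (s : V) :
    IsTraceReduced G (genStep G s w) := by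
  classical
  by_cases hs : MovesToFront G s w
  · rw [genStep_of_movesToFront hs]
    exact (hs.traceEquiv_cons_erase.isTraceReduced_iff.1 hw).2
  · rw [genStep_of_not_movesToFront hs]
    exact ⟨hs, hw⟩

theorem length_genStep_le (s : V) (w : List V) : (genStep G s w).length ≤ w.length + 1 := by
  classical
  unfold genStep
  split_ifs
  · exact List.length_erase_le.trans (Nat.le_succ _)
  · rfl

theorem TraceEquiv.genStep_congr {u v : List V} (h : TraceEquiv G u v) (s : V) :
    TraceEquiv G (genStep G s u) (genStep G s v) := by
  classical
  by_cases hs : MovesToFront G s u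
  · rw [genStep_of_movesToFront hs, genStep_of_movesToFront ((h.movesToFront_iff s).1 hs)]
    exact h.erase s
  · rw [genStep_of_not_movesToFront hs,
      genStep_of_not_movesToFront fun hv => hs ((h.movesToFront_iff s).2 hv)]
    exact h.cons s

theorem IsTraceReduced.traceEquiv_genStep_genStep {w : List V} (hw : IsTraceReduced G w) (s : V) :
    TraceEquiv G (genStep G s (genStep G s w)) w := by
  classical
  by_cases hs : MovesToFront G s w
  · have hs' : ¬MovesToFront G s (w.erase s) :=
      (hs.traceEquiv_cons_erase.isTraceReduced_iff.1 hw).1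
    rw [genStep_of_movesToFront hs, genStep_of_not_movesToFront hs']
    exact hs.traceEquiv_cons_erase.symm
  · have hs' : MovesToFront G s (s :: w) := Or.inl rfl
    rw [genStep_of_not_movesToFront hs, genStep_of_movesToFront hs', List.erase_cons_head]
    exact TraceEquiv.refl w

theorem traceEquiv_genStep_comm {s t : V} (h : G.Adj s t) (w : List V) :
    TraceEquiv G (genStep G s (genStep G t w)) (genStep G t (genStep G s w)) := by
  classical
  have hst := h.ne
  have hts := h.ne'
  have cons_s := fun w => movesToFront_cons_iff_of_adj (w := w) h
  have cons_t := fun w => movesToFront_cons_iff_of_adj (w := w) h.symm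
  by_cases hs : MovesToFront G s w <;> by_cases ht : MovesToFront G t w
  · simpa [genStep, hs, ht, ht.erase_iff_of_adj h, hs.erase_iff_of_adj h.symm, List.erase_comm]
      using TraceEquiv.refl _
  · simpa [genStep, hs, ht, cons_s, hs.erase_iff_of_adj h.symm, List.erase_cons, hts]
      using TraceEquiv.refl _
  · simpa [genStep, hs, ht, cons_t, ht.erase_iff_of_adj h, List.erase_cons, hst]
      using TraceEquiv.refl _
  · simpa [genStep, hs, ht, cons_s, cons_t] using TraceEquiv.swap h w

/-- Trace-reduced words up to commutations, which are normal forms for the elements of the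
right-angled Coxeter group. -/
def reducedSetoid (G : SimpleGraph V) : Setoid {w : List V // IsTraceReduced G w} where
  r u v := TraceEquiv G u v
  iseqv := ⟨fun u => .refl u.1, .symm, .trans⟩

/-- The action of a generator on trace-reduced words up to commutations. -/
noncomputable def genAction (G : SimpleGraph V) (s : V) :
    Function.End (Quotient (reducedSetoid G)) :=
  Quotient.map (fun w => ⟨genStep G s w.1, w.2.genStep_isTraceReduced s⟩)
    fun _ _ h => TraceEquiv.genStep_congr h s

theorem genAction_mul_self (s : V) : genAction G s * genAction G s = 1 := by
  funext q
  induction q using Quotient.inductionOn with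
  | h w => exact Quotient.sound (w.2.traceEquiv_genStep_genStep s)

theorem genAction_commute {s t : V} (h : G.Adj s t) : Commute (genAction G s) (genAction G t) := by
  funext q
  induction q using Quotient.inductionOn with
  | h w => exact Quotient.sound (traceEquiv_genStep_comm h w.1)

theorem racgMatrix_apply_of_adj {s t : V} (h : G.Adj s t) : (racgMatrix G).M s t = 2 := by
  simp [racgMatrix, h.ne, h]

theorem isLiftable_genAction : (racgMatrix G).IsLiftable (genAction G) := by
  intro s t
  by_cases hst : s = t
  · simp [hst, genAction_mul_self]
  by_cases h : G.Adj s t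
  · rw [racgMatrix_apply_of_adj h, (genAction_commute h).mul_pow, pow_two, pow_two,
      genAction_mul_self, genAction_mul_self, one_mul]
  · simp [racgMatrix, hst, h]

/-- The action of the right-angled Coxeter group on trace-reduced words up to commutations. -/
noncomputable def racgAction (G : SimpleGraph V) :
    RACG G →* Function.End (Quotient (reducedSetoid G)) :=
  (racgSystem G).lift ⟨genAction G, isLiftable_genAction⟩

theorem racgAction_wordProd_nil (q : Quotient (reducedSetoid G)) :
    racgAction G ((racgSystem G).wordProd []) q = q := by
  rw [CoxeterSystem.wordProd_nil, map_one]
  rfl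

theorem racgAction_wordProd_cons (s : V) (w : List V) (q : Quotient (reducedSetoid G)) :
    racgAction G ((racgSystem G).wordProd (s :: w)) q =
      genAction G s (racgAction G ((racgSystem G).wordProd w) q) := by
  rw [CoxeterSystem.wordProd_cons, map_mul, racgAction,
    CoxeterSystem.lift_apply_simple _ isLiftable_genAction]
  rfl

theorem IsTraceReduced.racgAction_wordProd {w : List V} (hw : IsTraceReduced G w) :
    racgAction G ((racgSystem G).wordProd w) ⟦⟨[], trivial⟩⟧ = ⟦⟨w, hw⟩⟧ := by
  induction w with
  | nil => exact racgAction_wordProd_nil _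
  | cons s w ih =>
    rw [racgAction_wordProd_cons, ih hw.2]
    exact congrArg (Quotient.mk _) (Subtype.ext (if_neg hw.1))

/-- The common length of the words in an equivalence class. -/
def reducedLength : Quotient (reducedSetoid G) → ℕ :=
  Quotient.lift (fun w => w.1.length) fun _ _ h => (TraceEquiv.perm h).length_eq

theorem reducedLength_genAction_le (s : V) (q : Quotient (reducedSetoid G)) :
    reducedLength (genAction G s q) ≤ reducedLength q + 1 := by
  induction q using Quotient.inductionOn with
  | h w => exact length_genStep_le s w.1

theorem reducedLength_racgAction_wordProd_le (v : List V) (q : Quotient (reducedSetoid G)) :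
    reducedLength (racgAction G ((racgSystem G).wordProd v) q) ≤ v.length + reducedLength q := by
  induction v with
  | nil => rw [racgAction_wordProd_nil, List.length_nil, Nat.zero_add]
  | cons s v ih =>
    rw [racgAction_wordProd_cons, List.length_cons, Nat.add_right_comm]
    exact (reducedLength_genAction_le s _).trans (Nat.succ_le_succ ih)

theorem IsTraceReduced.isGeodesicWord {w : List V} (hw : IsTraceReduced G w) :
    IsGeodesicWord G w := by
  refine le_antisymm ((racgSystem G).length_wordProd_le w) ?_
  obtain ⟨v, hv, hvw⟩ := (racgSystem G).exists_isReduced ((racgSystem G).wordProd w)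
  have hle := reducedLength_racgAction_wordProd_le (G := G) v ⟦⟨[], trivial⟩⟧
  rw [← hvw, hw.racgAction_wordProd] at hle
  rw [hvw, hv.eq]
  exact hle

theorem simple_commute_of_adj {s t : V} (h : G.Adj s t) :
    Commute ((racgSystem G).simple s) ((racgSystem G).simple t) := by
  have hpow := (racgSystem G).simple_mul_simple_pow s t
  rw [racgMatrix_apply_of_adj h, pow_two, mul_eq_one_iff_eq_inv, mul_inv_rev] at hpow
  simpa [Commute, SemiconjBy] using hpow

theorem TraceEquiv.wordProd_eq {u v : List V} (h : TraceEquiv G u v) :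
    (racgSystem G).wordProd u = (racgSystem G).wordProd v := by
  induction h with
  | nil => rfl
  | cons s _ ih => rw [CoxeterSystem.wordProd_cons, CoxeterSystem.wordProd_cons, ih]
  | swap h w =>
    simp only [CoxeterSystem.wordProd_cons, ← mul_assoc, (simple_commute_of_adj h).eq]
  | trans _ _ ih₁ ih₂ => exact ih₁.trans ih₂

theorem IsGeodesicWord.isTraceReduced {w : List V} (h : IsGeodesicWord G w) :
    IsTraceReduced G w := by
  classical
  induction w with
  | nil => trivial
  | cons s w ih =>
    refine ⟨fun hs => ?_, ih (CoxeterSystem.IsReduced.drop (cs := racgSystem G) h 1)⟩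
    have hprod : (racgSystem G).wordProd (s :: w) = (racgSystem G).wordProd (w.erase s) := by
      rw [CoxeterSystem.wordProd_cons, hs.traceEquiv_cons_erase.wordProd_eq,
        CoxeterSystem.wordProd_cons, CoxeterSystem.simple_mul_simple_cancel_left]
    have hle := (racgSystem G).length_wordProd_le (w.erase s)
    rw [← hprod, h] at hle
    exact absurd (hle.trans List.length_erase_le) (Nat.not_succ_le_self _)

theorem isGeodesicWord_iff {w : List V} : IsGeodesicWord G w ↔ IsTraceReduced G w :=
  ⟨IsGeodesicWord.isTraceReduced, IsTraceReduced.isGeodesicWord⟩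

end Words

section Counting

open Finset

variable {V : Type*}

/-- The words of length `m` whose concatenation with `w` is reduced. -/
def reducedExtensions (G : SimpleGraph V) (m : ℕ) (w : List V) : Set (List V) :=
  {u | u.length = m ∧ IsTraceReduced G (u ++ w)}

theorem geodesicGrowth_eq_ncard_reducedExtensions (G : SimpleGraph V) (m : ℕ) :
    geodesicGrowth G m = (reducedExtensions G m []).ncard := by
  simp only [geodesicGrowth, isGeodesicWord_iff, reducedExtensions, List.append_nil]

theorem ncard_reducedExtensions_zero {G : SimpleGraph V} {w : List V} (hw : IsTraceReduced G w) :
    (reducedExtensions G 0 w).ncard = 1 := by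
  refine Set.ncard_eq_one.2 ⟨[], Set.ext fun u => ?_⟩
  simp only [reducedExtensions, List.length_eq_zero_iff, Set.mem_ofPred_eq,
    Set.mem_singleton_iff, and_iff_left_iff_imp]
  rintro rfl
  exact hw

theorem reducedExtensions_finite [Finite V] (G : SimpleGraph V) (m : ℕ) (w : List V) :
    (reducedExtensions G m w).Finite :=
  (List.finite_length_eq V m).subset fun _ hu => hu.1

theorem reducedExtensions_succ (G : SimpleGraph V) (m : ℕ) (w : List V) :
    reducedExtensions G (m + 1) w =
      ⋃ c ∈ {c | ¬MovesToFront G c w}, (· ++ [c]) '' reducedExtensions G m (c :: w) := by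
  ext u
  simp only [reducedExtensions, Set.mem_iUnion, Set.mem_image, Set.mem_ofPred_eq, exists_prop]
  constructor
  · rintro ⟨hu, hr⟩
    obtain ⟨u, c, rfl⟩ : ∃ u' c, u = u' ++ [c] :=
      ((List.eq_nil_or_concat' u).resolve_left (by rintro rfl; simp at hu))
    rw [List.append_assoc] at hr
    exact ⟨c, hr.of_append.1, u, ⟨by simpa using hu, hr⟩, rfl⟩
  · rintro ⟨c, -, u, ⟨hu, hr⟩, rfl⟩
    exact ⟨by simpa using hu, by simpa using hr⟩

variable [DecidableEq V]

/-- The letters that commutations can bring to the front of a word. -/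
def leadSet (G : SimpleGraph V) [DecidableRel G.Adj] : List V → Finset V
  | [] => ∅
  | c :: w => insert c {a ∈ leadSet G w | G.Adj c a}

theorem mem_leadSet {G : SimpleGraph V} [DecidableRel G.Adj] {s : V} {w : List V} :
    s ∈ leadSet G w ↔ MovesToFront G s w := by
  induction w with
  | nil => simp [leadSet, MovesToFront]
  | cons c w ih => simp [leadSet, MovesToFront, ih, G.adj_comm, and_comm]

variable [Fintype V] (G : SimpleGraph V) [DecidableRel G.Adj]

/-- The number of ways to extend a reduced word with the given set of leading letters by a given
number of letters on the left, keeping it reduced. -/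
def extCount : ℕ → Finset V → ℕ
  | 0, _ => 1
  | m + 1, F => ∑ c ∈ Fᶜ, extCount m (insert c {a ∈ F | G.Adj c a})

variable {G}

theorem ncard_reducedExtensions_succ (m : ℕ) (w : List V) :
    (reducedExtensions G (m + 1) w).ncard =
      ∑ c ∈ (leadSet G w)ᶜ, (reducedExtensions G m (c :: w)).ncard := by
  have hset : {c | ¬MovesToFront G c w} = ↑(leadSet G w)ᶜ := by
    ext c
    simp [mem_leadSet]
  rw [reducedExtensions_succ, hset, Set.Finite.ncard_biUnion (Finset.finite_toSet _)
    (fun c _ => (reducedExtensions_finite G m (c :: w)).image _), finsum_mem_coe_finset]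
  · exact sum_congr rfl fun c _ => Set.ncard_image_of_injective _ (List.append_left_injective [c])
  · intro c _ d _ hcd
    refine Set.disjoint_left.2 ?_
    rintro _ ⟨u, -, rfl⟩ ⟨v, -, hv⟩
    exact hcd (List.cons.inj (List.append_inj_right' hv rfl)).1.symm

theorem ncard_reducedExtensions (m : ℕ) {w : List V} (hw : IsTraceReduced G w) :
    (reducedExtensions G m w).ncard = extCount G m (leadSet G w) := by
  induction m generalizing w with
  | zero => exact ncard_reducedExtensions_zero hw
  | succ m ih =>
    rw [ncard_reducedExtensions_succ, extCount]
    refine sum_congr rfl fun c hc => ih ⟨?_, hw⟩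
    rwa [mem_compl, mem_leadSet] at hc

theorem geodesicGrowth_eq_extCount (m : ℕ) : geodesicGrowth G m = extCount G m ∅ := by
  rw [geodesicGrowth_eq_ncard_reducedExtensions, ncard_reducedExtensions m (w := []) trivial,
    leadSet]

end Counting

section Series

open Finset PowerSeries Matrix

variable {V : Type*} [Fintype V] [DecidableEq V] (G : SimpleGraph V) [DecidableRel G.Adj]

/-- The generating series of the reduced extensions of a word with the given set of leading
letters. -/
noncomputable def extSeries (F : Finset V) : ℤ⟦X⟧ := mk fun m => extCount G m F

/-- The contribution to the growth lost because the neighbors of `v` commute with `v`. -/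
noncomputable def commutationDefect (v : V) : ℤ⟦X⟧ :=
  ∑ c ∈ G.neighborFinset v, (extSeries G {c} - extSeries G {v, c})

variable {G}

theorem map_geodesicGrowthSeries :
    (geodesicGrowthSeries G).map (Nat.castRingHom ℤ) = extSeries G ∅ := by
  ext m
  simp [geodesicGrowthSeries, extSeries, geodesicGrowth_eq_extCount]

theorem extSeries_eq_one_add (F : Finset V) :
    extSeries G F = 1 + X * ∑ c ∈ Fᶜ, extSeries G (insert c {a ∈ F | G.Adj c a}) := by
  ext (_ | m)
  · simp [extSeries, extCount]
  · simp [extSeries, extCount, coeff_succ_X_mul, map_sum, coeff_one]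

theorem extSeries_insert_filter_adj {F : Finset V} {c : V} (h : #{a ∈ F | G.Adj c a} ≤ 1) :
    extSeries G (insert c {a ∈ F | G.Adj c a}) =
      extSeries G {c} - ∑ a ∈ F with G.Adj c a, (extSeries G {c} - extSeries G {a, c}) := by
  obtain h | ⟨a, h⟩ := (Nat.le_one_iff_eq_zero_or_eq_one.1 h).imp card_eq_zero.1 card_eq_one.1
  · simp [h]
  · simp [h, pair_comm]

theorem extSeries_eq_extSeries_empty_sub {F : Finset V}
    (h : ∀ c ∉ F, #{a ∈ F | G.Adj c a} ≤ 1) :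
    extSeries G F = extSeries G ∅ - X * ∑ c ∈ F, extSeries G {c} -
      X * ∑ a ∈ F, (commutationDefect G a -
        ∑ c ∈ F with G.Adj c a, (extSeries G {c} - extSeries G {a, c})) := by
  have hempty : extSeries G ∅ = 1 + X * ∑ c, extSeries G {c} := by
    simpa using extSeries_eq_one_add (G := G) ∅
  have hdefect (a : V) : commutationDefect G a -
        ∑ c ∈ F with G.Adj c a, (extSeries G {c} - extSeries G {a, c}) =
      ∑ c ∈ Fᶜ with G.Adj c a, (extSeries G {c} - extSeries G {a, c}) := by
    rw [commutationDefect, sub_eq_iff_eq_add, SimpleGraph.neighborFinset_eq_filter,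
      sum_filter, sum_filter, sum_filter, add_comm, sum_add_sum_compl]
    simp only [G.adj_comm]
  have hswap : ∑ c ∈ Fᶜ, ∑ a ∈ F with G.Adj c a, (extSeries G {c} - extSeries G {a, c}) =
      ∑ a ∈ F, ∑ c ∈ Fᶜ with G.Adj c a, (extSeries G {c} - extSeries G {a, c}) := by
    simp only [sum_filter]
    exact sum_comm
  rw [extSeries_eq_one_add, hempty, ← sum_add_sum_compl F,
    sum_congr rfl fun c hc => extSeries_insert_filter_adj (h c (mem_compl.1 hc)),
    sum_sub_distrib, hswap, sum_congr rfl fun a _ => hdefect a]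
  ring

theorem one_add_X_mul_extSeries_singleton (v : V) :
    (1 + X) * extSeries G {v} = extSeries G ∅ - X * commutationDefect G v := by
  have h := extSeries_eq_extSeries_empty_sub (G := G) (F := {v}) fun c _ =>
    (card_filter_le _ _).trans_eq (card_singleton v)
  simp only [sum_singleton, filter_singleton, G.irrefl, if_false, sum_empty, sub_zero] at h
  linear_combination h

theorem one_add_two_X_mul_extSeries_pair (hG : G.CliqueFree 3) {a b : V} (hab : G.Adj a b) :
    (1 + 2 * X) * extSeries G {a, b} =
      (1 + X) * (extSeries G {a} + extSeries G {b}) - extSeries G ∅ := by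
  have hcard : ∀ c ∉ ({a, b} : Finset V), #{x ∈ ({a, b} : Finset V) | G.Adj c x} ≤ 1 := by
    intro c _
    by_contra! hc
    have hall := filter_card_eq
      (le_antisymm (card_filter_le _ _) ((card_le_two).trans hc))
    exact hG {c, a, b} (SimpleGraph.is3Clique_triple_iff.2
      ⟨hall a (by simp), hall b (by simp), hab⟩)
  have h := extSeries_eq_extSeries_empty_sub hcard
  simp only [sum_pair hab.ne, filter_insert, filter_singleton, G.irrefl, hab, hab.symm, if_true,
    if_false, insert_empty_eq, sum_singleton, pair_comm b a] at h
  linear_combination h - one_add_X_mul_extSeries_singleton (G := G) a -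
    one_add_X_mul_extSeries_singleton (G := G) b

variable (G) in
/-- The matrix `(1 + X)(1 + 2X) - X(1 + X) D + X² A`, where `A` is the adjacency matrix and `D` the
degree matrix; the geodesic growth series of a triangle-free graph is read off its inverse. -/
noncomputable def growthMatrix : Matrix V V ℤ⟦X⟧ :=
  ((1 + X) * (1 + 2 * X) : ℤ⟦X⟧) • 1 - (X * (1 + X) : ℤ⟦X⟧) • G.degMatrix ℤ⟦X⟧ +
    (X ^ 2 : ℤ⟦X⟧) • G.adjMatrix ℤ⟦X⟧

variable (G) in
/-- The sum of all entries of the inverse of the growth matrix. -/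
noncomputable def growthSum : ℤ⟦X⟧ := 1 ⬝ᵥ (growthMatrix G)⁻¹ *ᵥ 1

theorem growthMatrix_mulVec_apply (z : V → ℤ⟦X⟧) (v : V) :
    (growthMatrix G *ᵥ z) v = (1 + X) * (1 + 2 * X) * z v -
      X * (1 + X) * ((G.degree v : ℤ⟦X⟧) * z v) +
      X ^ 2 * ∑ u ∈ G.neighborFinset v, z u := by
  simp only [growthMatrix, add_mulVec, sub_mulVec, smul_mulVec, one_mulVec, Pi.add_apply,
    Pi.sub_apply, Pi.smul_apply, smul_eq_mul, SimpleGraph.degMatrix_mulVec_apply,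
    SimpleGraph.adjMatrix_mulVec_apply]

theorem growthMatrix_isSymm : (growthMatrix G).IsSymm :=
  ((isSymm_one.smul _).sub ((G.isSymm_degMatrix ℤ⟦X⟧).smul _)).add
    ((SimpleGraph.isSymm_adjMatrix G).smul _)

theorem isUnit_det_growthMatrix : IsUnit (growthMatrix G).det := by
  have hmap : (growthMatrix G).map constantCoeff = 1 := by
    ext u v
    by_cases huv : u = v <;>
      simp [growthMatrix, one_apply, huv, SimpleGraph.degMatrix, apply_ite constantCoeff]
  rw [isUnit_iff_constantCoeff, RingHom.map_det, RingHom.mapMatrix_apply, hmap, det_one]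
  exact isUnit_one

theorem growthMatrix_mulVec_inv_mulVec (z : V → ℤ⟦X⟧) :
    growthMatrix G *ᵥ (growthMatrix G)⁻¹ *ᵥ z = z := by
  rw [mulVec_mulVec, mul_nonsing_inv _ isUnit_det_growthMatrix, one_mulVec]

theorem inv_mulVec_growthMatrix_mulVec (z : V → ℤ⟦X⟧) :
    (growthMatrix G)⁻¹ *ᵥ growthMatrix G *ᵥ z = z := by
  rw [mulVec_mulVec, nonsing_inv_mul _ isUnit_det_growthMatrix, one_mulVec]

theorem growthMatrix_mulVec_extSeries (hG : G.CliqueFree 3) :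
    growthMatrix G *ᵥ (fun v => extSeries G ∅ - extSeries G {v}) =
      (X * (1 + 2 * X) * extSeries G ∅) • 1 := by
  funext v
  have hneighbor : ∀ c ∈ G.neighborFinset v, (1 + 2 * X) * (extSeries G {c} - extSeries G {v, c}) =
      (1 + X) * (extSeries G ∅ - extSeries G {v}) - X * (extSeries G ∅ - extSeries G {c}) := by
    intro c hc
    linear_combination -one_add_two_X_mul_extSeries_pair hG ((G.mem_neighborFinset v c).1 hc)
  have hdefect : (1 + 2 * X) * commutationDefect G v =
      (G.degree v : ℤ⟦X⟧) * ((1 + X) * (extSeries G ∅ - extSeries G {v})) -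
        X * ∑ c ∈ G.neighborFinset v, (extSeries G ∅ - extSeries G {c}) := by
    rw [commutationDefect, mul_sum, sum_congr rfl hneighbor, sum_sub_distrib, sum_const,
      nsmul_eq_mul, ← mul_sum, SimpleGraph.card_neighborFinset_eq_degree]
  rw [growthMatrix_mulVec_apply, Pi.smul_apply, Pi.one_apply, smul_eq_mul, mul_one]
  linear_combination
    X * hdefect - (1 + 2 * X) * one_add_X_mul_extSeries_singleton (G := G) v

theorem geodesicGrowthSeries_mul_eq_one (hG : G.CliqueFree 3) :
    (geodesicGrowthSeries G).map (Nat.castRingHom ℤ) *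
      (1 - (Fintype.card V : ℤ⟦X⟧) * X + X ^ 2 * (1 + 2 * X) * growthSum G) = 1 := by
  have hsum : ∑ v, (extSeries G ∅ - extSeries G {v}) =
      X * (1 + 2 * X) * extSeries G ∅ * growthSum G := by
    have hvec := congrArg (1 ⬝ᵥ (growthMatrix G)⁻¹ *ᵥ ·) (growthMatrix_mulVec_extSeries hG)
    simpa only [inv_mulVec_growthMatrix_mulVec, mulVec_smul, dotProduct_smul, smul_eq_mul,
      one_dotProduct (fun v => extSeries G ∅ - extSeries G {v}), growthSum] using hvec
  have hempty : extSeries G ∅ = 1 + X * ∑ v, extSeries G {v} := by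
    simpa using extSeries_eq_one_add (G := G) ∅
  rw [sum_sub_distrib, sum_const, card_univ, nsmul_eq_mul] at hsum
  rw [map_geodesicGrowthSeries]
  linear_combination hempty - X * hsum

theorem growthSum_eq_of_geodesicGrowthSeries_eq {W : Type*} [Fintype W] [DecidableEq W]
    {H : SimpleGraph W} [DecidableRel H.Adj] (hG : G.CliqueFree 3) (hH : H.CliqueFree 3)
    (hcard : Fintype.card V = Fintype.card W)
    (h : geodesicGrowthSeries G = geodesicGrowthSeries H) : growthSum G = growthSum H := by
  have hmul := geodesicGrowthSeries_mul_eq_one hG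
  rw [h, hcard] at hmul
  have hinv := left_inv_eq_right_inv (mul_comm _ _ |>.trans hmul)
    (geodesicGrowthSeries_mul_eq_one hH)
  have hne : (X ^ 2 * (1 + 2 * X) : ℤ⟦X⟧) ≠ 0 :=
    mul_ne_zero (pow_ne_zero 2 X_ne_zero) fun h0 => by simpa using congrArg constantCoeff h0
  exact mul_left_cancel₀ hne (add_left_cancel hinv)

end Series

section Recurrence

open Finset PowerSeries Matrix

variable {V : Type*} [Fintype V] [DecidableEq V] (G : SimpleGraph V) [DecidableRel G.Adj]

/-- The coefficients of the solution `z` of `growthMatrix G *ᵥ z = C ∘ b`. -/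
def growthSolution (b : V → ℤ) : ℕ → V → ℤ
  | 0, v => b v
  | 1, v => (G.degree v - 3) * b v
  | k + 2, v => (G.degree v - 3) * growthSolution b (k + 1) v +
      (G.degree v - 2) * growthSolution b k v - ∑ u ∈ G.neighborFinset v, growthSolution b k u

variable {G}

theorem growthMatrix_mulVec_growthSolution (b : V → ℤ) :
    growthMatrix G *ᵥ (fun v => mk fun k => growthSolution G b k v) = C ∘ b := by
  funext v
  have hnested (z : V → ℤ⟦X⟧) : (growthMatrix G *ᵥ z) v = z v + X * (C (3 - G.degree v : ℤ) * z v +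
      X * (C (2 - G.degree v : ℤ) * z v + ∑ u ∈ G.neighborFinset v, z u)) := by
    rw [growthMatrix_mulVec_apply]
    simp only [map_sub, map_natCast, map_ofNat]
    ring
  rw [hnested]
  ext (_ | _ | k)
  · simp [growthSolution]
  · simp only [map_add, coeff_succ_X_mul, coeff_zero_X_mul, coeff_C_mul, coeff_mk,
      growthSolution, Function.comp_apply, coeff_C, Nat.succ_ne_zero, if_false]
    ring
  · simp only [map_add, coeff_succ_X_mul, coeff_C_mul, coeff_mk, map_sum, growthSolution,
      Function.comp_apply, coeff_C, Nat.succ_ne_zero, if_false]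
    ring

theorem coeff_growthMatrix_inv_mulVec (b : V → ℤ) (k : ℕ) (v : V) :
    coeff k (((growthMatrix G)⁻¹ *ᵥ (C ∘ b)) v) = growthSolution G b k v := by
  rw [← growthMatrix_mulVec_growthSolution (G := G), inv_mulVec_growthMatrix_mulVec, coeff_mk]

theorem coeff_growthMatrix_inv_mulVec_one (k : ℕ) (v : V) :
    coeff k (((growthMatrix G)⁻¹ *ᵥ 1) v) = growthSolution G 1 k v := by
  have hone : C ∘ (1 : V → ℤ) = (1 : V → ℤ⟦X⟧) := funext fun _ => map_one C
  rw [← coeff_growthMatrix_inv_mulVec, hone]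

theorem coeff_growthSum (k : ℕ) : coeff k (growthSum G) = ∑ v, growthSolution G 1 k v := by
  simp only [growthSum, one_dotProduct, map_sum, coeff_growthMatrix_inv_mulVec_one]

theorem coeff_growthMatrix_inv_apply (k : ℕ) (u v : V) :
    coeff k ((growthMatrix G)⁻¹ u v) = growthSolution G (Pi.single v 1) k u := by
  have hsingle : C ∘ Pi.single v 1 = Pi.single v (1 : ℤ⟦X⟧) := by
    funext u
    simp [Pi.single_apply, apply_ite C]
  rw [← coeff_growthMatrix_inv_mulVec, hsingle, mulVec_single_one, col_apply]

end Recurrence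

namespace coalescence

open Finset Matrix

variable {V W : Type*} {τ : SimpleGraph V} {r : V} {H : SimpleGraph W} {s : W}

@[simp]
theorem adj_inl_inl {a b : V} : (coalescence τ r H s).Adj (.inl a) (.inl b) ↔ τ.Adj a b :=
  Iff.rfl

@[simp]
theorem adj_inl_inr {a : V} {b : {w : W // w ≠ s}} :
    (coalescence τ r H s).Adj (.inl a) (.inr b) ↔ a = r ∧ H.Adj s b :=
  Iff.rfl

@[simp]
theorem adj_inr_inl {a : {w : W // w ≠ s}} {b : V} :
    (coalescence τ r H s).Adj (.inr a) (.inl b) ↔ b = r ∧ H.Adj s a :=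
  Iff.rfl

@[simp]
theorem adj_inr_inr {a b : {w : W // w ≠ s}} :
    (coalescence τ r H s).Adj (.inr a) (.inr b) ↔ H.Adj a b :=
  Iff.rfl

theorem cliqueFree_three (hτ : τ.CliqueFree 3) (hH : H.CliqueFree 3) :
    (coalescence τ r H s).CliqueFree 3 := by
  classical
  intro t ht
  obtain ⟨x, y, z, hxy, hxz, hyz, -⟩ := SimpleGraph.is3Clique_iff.1 ht
  have hτ' {a b c : V} (hab : τ.Adj a b) (hac : τ.Adj a c) (hbc : τ.Adj b c) : False :=
    hτ {a, b, c} (SimpleGraph.is3Clique_triple_iff.2 ⟨hab, hac, hbc⟩)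
  have hH' {a b c : W} (hab : H.Adj a b) (hac : H.Adj a c) (hbc : H.Adj b c) : False :=
    hH {a, b, c} (SimpleGraph.is3Clique_triple_iff.2 ⟨hab, hac, hbc⟩)
  rcases x with a | a <;> rcases y with b | b <;> rcases z with c | c
  · exact hτ' hxy hxz hyz
  · exact τ.irrefl (hyz.1 ▸ hxz.1 ▸ hxy)
  · exact τ.irrefl (hyz.1 ▸ hxy.1 ▸ hxz)
  · exact hH' hxy.2 hxz.2 hyz
  · exact τ.irrefl (hxy.1 ▸ hxz.1 ▸ hyz)
  · exact hH' hxy.2 hyz.2 hxz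
  · exact hH' hxz.2 hyz.2 hxy
  · exact hH' hxy hxz hyz

section Inclusion

variable [DecidableEq W]

/-- The inclusion of the vertices of the second graph into those of a coalescence. -/
def inr (r : V) (s : W) (w : W) : V ⊕ {w : W // w ≠ s} :=
  if h : w = s then .inl r else .inr ⟨w, h⟩

@[simp]
theorem inr_root : inr r s s = .inl r :=
  dif_pos rfl

@[simp]
theorem inr_coe (w : {w : W // w ≠ s}) : inr r s w = .inr w :=
  dif_neg w.2

/-- The first graph of a coalescence, included as a subgraph. -/
def inlHom (τ : SimpleGraph V) (r : V) (H : SimpleGraph W) (s : W) : τ →g coalescence τ r H s where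
  toFun := .inl
  map_rel' h := h

/-- The second graph of a coalescence, included as a subgraph. -/
def inrHom (τ : SimpleGraph V) (r : V) (H : SimpleGraph W) (s : W) : H →g coalescence τ r H s where
  toFun := inr r s
  map_rel' {a b} h := by
    rcases eq_or_ne a s with rfl | ha <;> rcases eq_or_ne b a with rfl | hba
    · exact (H.irrefl h).elim
    · rw [inr_root, inr_coe ⟨b, hba⟩]
      exact ⟨rfl, h⟩
    · exact (H.irrefl h).elim
    · rcases eq_or_ne b s with rfl | hb
      · rw [inr_root, inr_coe ⟨a, ha⟩]
        exact ⟨rfl, h.symm⟩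
      · rw [inr_coe ⟨a, ha⟩, inr_coe ⟨b, hb⟩]
        exact h

omit [DecidableEq W] in
theorem connected (hτ : τ.Connected) (hH : H.Connected) : (coalescence τ r H s).Connected := by
  classical
  have hroot (x) : (coalescence τ r H s).Reachable (.inl r) x := by
    rcases x with v | w
    · exact (hτ.preconnected r v).map (inlHom τ r H s)
    · simpa [inrHom] using (hH.preconnected s w).map (inrHom τ r H s)
  exact { preconnected := fun x y => (hroot x).symm.trans (hroot y), nonempty := ⟨.inl r⟩ }

theorem eq_of_comp_inl_of_comp_inr {α : Type*} {z z' : V ⊕ {w : W // w ≠ s} → α}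
    (hinl : z ∘ .inl = z' ∘ .inl) (hinr : z ∘ inr r s = z' ∘ inr r s) : z = z' := by
  funext x
  obtain v | w := x
  · exact congrFun hinl v
  · simpa using congrFun hinr w

theorem sum_inl_add_sum_inr [Fintype V] [Fintype W] {M : Type*} [AddCommMonoid M]
    (z : V ⊕ {w : W // w ≠ s} → M) :
    ∑ v, z (.inl v) + ∑ w, z (inr r s w) = ∑ x, z x + z (.inl r) := by
  rw [Fintype.sum_eq_add_sum_subtype_ne (fun w => z (inr r s w)) s, Fintype.sum_sum_type]
  simp only [inr_root, inr_coe]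
  abel

end Inclusion

theorem card_add_one [Fintype V] [Fintype W] [DecidableEq W] :
    Fintype.card (V ⊕ {w : W // w ≠ s}) + 1 = Fintype.card V + Fintype.card W := by
  have hpos : 0 < Fintype.card W := Fintype.card_pos_iff.2 ⟨s⟩
  rw [Fintype.card_sum, Fintype.card_subtype_compl, Fintype.card_subtype_eq]
  omega

section Adjacency

variable [Fintype V] [Fintype W] [DecidableEq W] [DecidableEq V] [DecidableRel τ.Adj]
  [DecidableRel H.Adj] [DecidableRel (coalescence τ r H s).Adj]

section

variable {R : Type*} [NonAssocSemiring R] (z : V ⊕ {w : W // w ≠ s} → R)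

theorem adjMatrix_mulVec_inl (v : V) :
    ((coalescence τ r H s).adjMatrix R *ᵥ z) (.inl v) =
      (τ.adjMatrix R *ᵥ (z ∘ .inl)) v +
        if v = r then (H.adjMatrix R *ᵥ (z ∘ inr r s)) s else 0 := by
  simp only [mulVec, dotProduct, SimpleGraph.adjMatrix_apply, Fintype.sum_sum_type,
    Function.comp_apply, adj_inl_inl, adj_inl_inr]
  rw [Fintype.sum_eq_add_sum_subtype_ne (fun w => (if H.Adj s w then _ else _) * _) s]
  by_cases hv : v = r <;> simp [hv]

omit [DecidableEq V] [DecidableRel τ.Adj] in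
theorem adjMatrix_mulVec_inr (w : {w : W // w ≠ s}) :
    ((coalescence τ r H s).adjMatrix R *ᵥ z) (.inr w) =
      (H.adjMatrix R *ᵥ (z ∘ inr r s)) w := by
  classical
  simp only [mulVec, dotProduct, SimpleGraph.adjMatrix_apply, Fintype.sum_sum_type,
    Function.comp_apply, adj_inr_inl, adj_inr_inr]
  rw [Fintype.sum_eq_add_sum_subtype_ne (fun u => (if H.Adj w u then _ else _) * _) s]
  simp [ite_and, H.adj_comm]

theorem adjMatrix_mulVec_comp_inl :
    ((coalescence τ r H s).adjMatrix R *ᵥ z) ∘ .inl = τ.adjMatrix R *ᵥ (z ∘ .inl) +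
      (H.adjMatrix R *ᵥ (z ∘ inr r s)) s • Pi.single r 1 := by
  funext v
  rw [Function.comp_apply, adjMatrix_mulVec_inl]
  simp [Pi.single_apply]

omit [DecidableEq V] in
theorem adjMatrix_mulVec_comp_inr :
    ((coalescence τ r H s).adjMatrix R *ᵥ z) ∘ inr r s = H.adjMatrix R *ᵥ (z ∘ inr r s) +
      (τ.adjMatrix R *ᵥ (z ∘ .inl)) r • Pi.single s 1 := by
  classical
  funext w
  rw [Function.comp_apply]
  obtain rfl | hw := eq_or_ne w s
  · rw [inr_root, adjMatrix_mulVec_inl]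
    simp [add_comm]
  · rw [inr_coe ⟨w, hw⟩, adjMatrix_mulVec_inr]
    simp [hw]

end

theorem degree_inl (v : V) : (coalescence τ r H s).degree (.inl v) =
    τ.degree v + if v = r then H.degree s else 0 := by
  simpa [Function.const_def, Function.comp_def] using
    adjMatrix_mulVec_inl (τ := τ) (H := H) (r := r) (s := s) (Function.const _ (1 : ℕ)) v

omit [DecidableEq V] [DecidableRel τ.Adj] in
theorem degree_inr (w : {w : W // w ≠ s}) : (coalescence τ r H s).degree (.inr w) =
    H.degree w := by
  simpa [Function.const_def, Function.comp_def] using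
    adjMatrix_mulVec_inr (τ := τ) (H := H) (r := r) (s := s) (Function.const _ (1 : ℕ)) w

omit [DecidableEq V] in
theorem card_edgeFinset : #(coalescence τ r H s).edgeFinset =
    #τ.edgeFinset + #H.edgeFinset := by
  classical
  have hsum : ∑ x, (coalescence τ r H s).degree x = ∑ v, τ.degree v + ∑ w, H.degree w := by
    rw [Fintype.sum_sum_type, Fintype.sum_eq_add_sum_subtype_ne (fun w => H.degree w) s]
    simp only [degree_inl, degree_inr, sum_add_distrib, sum_ite_eq', mem_univ, if_true, add_assoc]
  simp only [SimpleGraph.sum_degrees_eq_twice_card_edges] at hsum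
  omega

end Adjacency

theorem isTree [Finite V] [Finite W] (hτ : τ.IsTree) (hH : H.IsTree) :
    (coalescence τ r H s).IsTree := by
  classical
  have := Fintype.ofFinite V
  have := Fintype.ofFinite W
  refine SimpleGraph.isTree_iff_connected_and_card.2
    ⟨connected hτ.connected hH.connected, ?_⟩
  have hcard := card_add_one (V := V) (s := s)
  rw [← hτ.card_edgeFinset, ← hH.card_edgeFinset] at hcard
  rw [Nat.card_eq_fintype_card, Nat.card_eq_fintype_card, ← SimpleGraph.edgeFinset_card,
    card_edgeFinset]
  omega

end coalescence

section EdgeTerm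

open PowerSeries Matrix

variable {V : Type*} [Fintype V] [DecidableEq V] (G : SimpleGraph V) [DecidableRel G.Adj]

/-- The part of `(growthMatrix G *ᵥ z) v` contributed by the edges at `v`. It is additive under
coalescence, whereas the rest of the growth matrix does not depend on the graph. -/
noncomputable def edgeTerm (z : V → ℤ⟦X⟧) (v : V) : ℤ⟦X⟧ :=
  X ^ 2 * (G.adjMatrix ℤ⟦X⟧ *ᵥ z) v - X * (1 + X) * ((G.degree v : ℤ⟦X⟧) * z v)

variable {G}

theorem growthMatrix_mulVec_apply_eq_add_edgeTerm (z : V → ℤ⟦X⟧) (v : V) :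
    (growthMatrix G *ᵥ z) v = (1 + X) * (1 + 2 * X) * z v + edgeTerm G z v := by
  rw [growthMatrix_mulVec_apply, edgeTerm, SimpleGraph.adjMatrix_mulVec_apply]
  ring

end EdgeTerm

section CoalescenceGrowth

open Finset PowerSeries Matrix coalescence

variable {V W : Type*} [Fintype V] [DecidableEq V] [Fintype W] [DecidableEq W]

section OneCoalescence

variable {τ : SimpleGraph V} {r : V} {H : SimpleGraph W} {s : W} [DecidableRel τ.Adj]
  [DecidableRel H.Adj] [DecidableRel (coalescence τ r H s).Adj] {z : V ⊕ {w : W // w ≠ s} → ℤ⟦X⟧}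

theorem edgeTerm_coalescence_inl (v : V) : edgeTerm (coalescence τ r H s) z (.inl v) =
    edgeTerm τ (z ∘ .inl) v + if v = r then edgeTerm H (z ∘ inr r s) s else 0 := by
  rw [edgeTerm, edgeTerm, edgeTerm, adjMatrix_mulVec_inl, degree_inl]
  split_ifs with hv
  · subst hv
    simp only [Function.comp_apply, inr_root, Nat.cast_add]
    ring
  · simp only [Function.comp_apply, add_zero]

omit [DecidableEq V] [DecidableRel τ.Adj] in
theorem edgeTerm_coalescence_inr (w : {w : W // w ≠ s}) :
    edgeTerm (coalescence τ r H s) z (.inr w) = edgeTerm H (z ∘ inr r s) w := by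
  rw [edgeTerm, edgeTerm, adjMatrix_mulVec_inr, degree_inr, Function.comp_apply, inr_coe]

theorem growthMatrix_mulVec_comp_inl (hz : growthMatrix (coalescence τ r H s) *ᵥ z = 1) :
    growthMatrix τ *ᵥ (z ∘ .inl) = 1 - Pi.single r (edgeTerm H (z ∘ inr r s) s) := by
  funext v
  have hv := congrFun hz (.inl v)
  rw [growthMatrix_mulVec_apply_eq_add_edgeTerm, edgeTerm_coalescence_inl] at hv
  rw [growthMatrix_mulVec_apply_eq_add_edgeTerm, Pi.sub_apply, Pi.single_apply]
  exact eq_sub_of_add_eq ((add_assoc _ _ _).trans hv)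

theorem growthMatrix_mulVec_comp_inr (hz : growthMatrix (coalescence τ r H s) *ᵥ z = 1) :
    growthMatrix H *ᵥ (z ∘ inr r s) = 1 - Pi.single s (edgeTerm τ (z ∘ .inl) r) := by
  funext w
  rw [growthMatrix_mulVec_apply_eq_add_edgeTerm, Pi.sub_apply, Pi.single_apply,
    Function.comp_apply]
  obtain rfl | hw := eq_or_ne w s
  · have hroot := congrFun hz (.inl r)
    rw [growthMatrix_mulVec_apply_eq_add_edgeTerm, edgeTerm_coalescence_inl, if_pos rfl] at hroot
    rw [inr_root, if_pos rfl]
    linear_combination hroot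
  · have hw' := congrFun hz (.inr ⟨w, hw⟩)
    rw [growthMatrix_mulVec_apply_eq_add_edgeTerm, edgeTerm_coalescence_inr] at hw'
    rw [if_neg hw, sub_zero, inr_coe ⟨w, hw⟩]
    exact hw'

variable (τ r H s) in
/-- The source that a graph `τ` exerts on the root of `H` when the two are coalesced: on the
vertices of `H`, the solution `z` of `growthMatrix (coalescence τ r H s) *ᵥ z = 1` solves
`growthMatrix H *ᵥ z = 1 + Pi.single s (rootSource τ r H s)`. -/
noncomputable def rootSource : ℤ⟦X⟧ :=
  -edgeTerm τ (((growthMatrix (coalescence τ r H s))⁻¹ *ᵥ 1) ∘ .inl) r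

theorem inv_mulVec_one_comp_inr : ((growthMatrix (coalescence τ r H s))⁻¹ *ᵥ 1) ∘ inr r s =
    (growthMatrix H)⁻¹ *ᵥ 1 + rootSource τ r H s • (growthMatrix H)⁻¹.col s := by
  have h := congrArg ((growthMatrix H)⁻¹ *ᵥ ·) (growthMatrix_mulVec_comp_inr
    (growthMatrix_mulVec_inv_mulVec (G := coalescence τ r H s) 1))
  simpa only [inv_mulVec_growthMatrix_mulVec, mulVec_sub, mulVec_single, op_smul_eq_smul,
    rootSource, neg_smul, ← sub_eq_add_neg] using h

theorem inv_mulVec_one_inl_root : ((growthMatrix (coalescence τ r H s))⁻¹ *ᵥ 1) (.inl r) =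
    ((growthMatrix H)⁻¹ *ᵥ 1) s + rootSource τ r H s * (growthMatrix H)⁻¹ s s := by
  simpa using congrFun (inv_mulVec_one_comp_inr (τ := τ) (r := r) (H := H) (s := s)) s

omit [DecidableRel H.Adj] in
theorem growthMatrix_mulVec_inv_mulVec_one_comp_inl :
    growthMatrix τ *ᵥ (((growthMatrix (coalescence τ r H s))⁻¹ *ᵥ 1) ∘ .inl) =
      1 - Pi.single r (1 + rootSource τ r H s -
        (1 + X) * (1 + 2 * X) *
          ((growthMatrix (coalescence τ r H s))⁻¹ *ᵥ 1) (.inl r) : ℤ⟦X⟧) := by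
  classical
  have hz := growthMatrix_mulVec_inv_mulVec (G := coalescence τ r H s) 1
  rw [growthMatrix_mulVec_comp_inl hz]
  congr 2
  have hroot := congrFun (growthMatrix_mulVec_comp_inr hz) s
  rw [growthMatrix_mulVec_apply_eq_add_edgeTerm, Pi.sub_apply, Pi.single_eq_same,
    Function.comp_apply, inr_root, Pi.one_apply] at hroot
  rw [rootSource]
  linear_combination hroot

theorem growthSum_coalescence : growthSum (coalescence τ r H s) =
    ∑ v, ((growthMatrix (coalescence τ r H s))⁻¹ *ᵥ 1) (.inl v) + growthSum H +
      rootSource τ r H s * ((growthMatrix H)⁻¹ *ᵥ 1) s -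
        ((growthMatrix (coalescence τ r H s))⁻¹ *ᵥ 1) (.inl r) := by
  have hsymm : ∑ w, (growthMatrix H)⁻¹ w s = ((growthMatrix H)⁻¹ *ᵥ 1) s := by
    simp only [mulVec, dotProduct, Pi.one_apply, mul_one]
    exact sum_congr rfl fun w _ => (growthMatrix_isSymm (G := H)).inv.apply s w
  have hinr : ∑ w, ((growthMatrix (coalescence τ r H s))⁻¹ *ᵥ 1) (inr r s w) =
      growthSum H + rootSource τ r H s * ((growthMatrix H)⁻¹ *ᵥ 1) s := by
    rw [← hsymm, mul_sum, growthSum, one_dotProduct, ← sum_add_distrib]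
    exact sum_congr rfl fun w _ => congrFun inv_mulVec_one_comp_inr w
  rw [growthSum, one_dotProduct]
  linear_combination hinr - sum_inl_add_sum_inr (r := r) (s := s)
    ((growthMatrix (coalescence τ r H s))⁻¹ *ᵥ 1)

omit [DecidableRel H.Adj] in
theorem exists_rootSource_eq_X_mul :
    ∃ m : ℤ⟦X⟧, rootSource τ r H s = X * m ∧ constantCoeff m = τ.degree r := by
  set z := (growthMatrix (coalescence τ r H s))⁻¹ *ᵥ 1 with hz
  refine ⟨(1 + X) * ((τ.degree r : ℤ⟦X⟧) * z (.inl r)) -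
    X * (τ.adjMatrix ℤ⟦X⟧ *ᵥ (z ∘ .inl)) r, ?_, ?_⟩
  · rw [rootSource, edgeTerm, ← hz, Function.comp_apply]
    ring
  · have hconst : constantCoeff (z (.inl r)) = 1 := by
      rw [← coeff_zero_eq_constantCoeff_apply, hz, coeff_growthMatrix_inv_mulVec_one,
        growthSolution, Pi.one_apply]
    simp [hconst]

end OneCoalescence

variable {W' : Type*} [Fintype W'] [DecidableEq W'] {τ : SimpleGraph V} {r : V}
  {H : SimpleGraph W} {s : W} {H' : SimpleGraph W'} {s' : W'} [DecidableRel τ.Adj]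
  [DecidableRel H.Adj] [DecidableRel H'.Adj] [DecidableRel (coalescence τ r H s).Adj]
  [DecidableRel (coalescence τ r H' s').Adj]

omit [DecidableRel H.Adj] [DecidableRel H'.Adj] in
theorem sum_inv_mulVec_one_inl_sub :
    ∑ v, ((growthMatrix (coalescence τ r H s))⁻¹ *ᵥ 1) (.inl v) -
        ∑ v, ((growthMatrix (coalescence τ r H' s'))⁻¹ *ᵥ 1) (.inl v) =
      (1 + rootSource τ r H' s') * ((growthMatrix (coalescence τ r H s))⁻¹ *ᵥ 1) (.inl r) -
        (1 + rootSource τ r H s) * ((growthMatrix (coalescence τ r H' s'))⁻¹ *ᵥ 1) (.inl r) := by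
  set z := (growthMatrix (coalescence τ r H s))⁻¹ *ᵥ 1 with hz
  set z' := (growthMatrix (coalescence τ r H' s'))⁻¹ *ᵥ 1 with hz'
  have hsymm : (z ∘ .inl) ⬝ᵥ growthMatrix τ *ᵥ (z' ∘ .inl) =
      (z' ∘ .inl) ⬝ᵥ growthMatrix τ *ᵥ (z ∘ .inl) := by
    rw [dotProduct_mulVec, ← mulVec_transpose, growthMatrix_isSymm, dotProduct_comm]
  rw [hz, hz', growthMatrix_mulVec_inv_mulVec_one_comp_inl,
    growthMatrix_mulVec_inv_mulVec_one_comp_inl, ← hz, ← hz'] at hsymm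
  simp only [dotProduct_sub, dotProduct_one, dotProduct_single, Function.comp_apply] at hsymm
  linear_combination hsymm

/-- The contributions of `τ` to the two sums enter only through the sources at the root: the rest
cancels because the growth matrix of `τ` is symmetric. -/
theorem growthSum_coalescence_sub :
    growthSum (coalescence τ r H s) - growthSum (coalescence τ r H' s') =
      (growthSum H - growthSum H') +
      (rootSource τ r H s + rootSource τ r H' s') *
        (((growthMatrix H)⁻¹ *ᵥ 1) s - ((growthMatrix H')⁻¹ *ᵥ 1) s') +
      rootSource τ r H s * rootSource τ r H' s' *
        ((growthMatrix H)⁻¹ s s - (growthMatrix H')⁻¹ s' s') := by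
  have hroot := inv_mulVec_one_inl_root (τ := τ) (r := r) (H := H) (s := s)
  have hroot' := inv_mulVec_one_inl_root (τ := τ) (r := r) (H := H') (s := s')
  rw [growthSum_coalescence, growthSum_coalescence]
  linear_combination sum_inv_mulVec_one_inl_sub (τ := τ) (r := r) (H := H) (s := s) (H' := H')
    (s' := s') + rootSource τ r H' s' * hroot - rootSource τ r H s * hroot'

theorem growthSum_coalescence_ne {k : ℕ} (hr : 0 < τ.degree r)
    (hsum : X ^ (k + 2) ∣ growthSum H - growthSum H')
    (hroot : X ^ k ∣ ((growthMatrix H)⁻¹ *ᵥ 1) s - ((growthMatrix H')⁻¹ *ᵥ 1) s')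
    (hroot_ne : coeff k (((growthMatrix H)⁻¹ *ᵥ 1) s - ((growthMatrix H')⁻¹ *ᵥ 1) s') ≠ 0)
    (hentry : X ^ k ∣ (growthMatrix H)⁻¹ s s - (growthMatrix H')⁻¹ s' s') :
    growthSum (coalescence τ r H s) ≠ growthSum (coalescence τ r H' s') := by
  intro heq
  obtain ⟨m, hm, hm0⟩ := exists_rootSource_eq_X_mul (τ := τ) (r := r) (H := H) (s := s)
  obtain ⟨m', hm', hm0'⟩ := exists_rootSource_eq_X_mul (τ := τ) (r := r) (H := H') (s := s')
  obtain ⟨a, ha⟩ := hsum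
  obtain ⟨b, hb⟩ := hroot
  obtain ⟨c, hc⟩ := hentry
  have hfactor : X ^ (k + 1) * ((m + m') * b + X * (a + m * m' * c)) = 0 := by
    have hsub := growthSum_coalescence_sub (τ := τ) (r := r) (H := H) (s := s) (H' := H')
      (s' := s')
    rw [heq, sub_self, hm, hm', ha, hb, hc] at hsub
    linear_combination -hsub
  have hconst := congrArg constantCoeff
    ((mul_eq_zero.1 hfactor).resolve_left (pow_ne_zero _ X_ne_zero))
  have hb0 : constantCoeff b ≠ 0 := by
    rwa [hb, coeff_X_pow_mul', if_pos le_rfl, Nat.sub_self, coeff_zero_eq_constantCoeff_apply]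
      at hroot_ne
  simp only [map_add, map_mul, hm0, hm0', constantCoeff_X, zero_mul, add_zero, map_zero,
    mul_eq_zero, hb0, or_false] at hconst
  omega

end CoalescenceGrowth

section Similarity

open Matrix Polynomial

theorem charpoly_eq_of_mul_eq_mul {ι R : Type*} [Fintype ι] [DecidableEq ι] [CommRing R]
    [IsDomain R] {A B P : Matrix ι ι R} (hP : P.det ≠ 0) (h : P * A = B * P) :
    A.charpoly = B.charpoly := by
  have hmap : P.map C * A.charmatrix = B.charmatrix * P.map C := by
    simp only [charmatrix, mul_sub, sub_mul, RingHom.mapMatrix_apply, ← Matrix.map_mul, h]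
    rw [(scalar_commute _ (fun _ => Commute.all _ _) _).eq]
  have hdet : (P.map C).det ≠ 0 := by
    rw [← RingHom.mapMatrix_apply, ← RingHom.map_det]
    exact C_ne_zero.2 hP
  have hmul := congrArg det hmap
  rw [det_mul, det_mul, mul_comm] at hmul
  exact mul_right_cancel₀ hdet hmul

theorem cospectral_iff {V W : Type*} [Fintype V] [Fintype W] [DecidableEq V] [DecidableEq W]
    {G : SimpleGraph V} {H : SimpleGraph W} [DecidableRel G.Adj] [DecidableRel H.Adj] :
    Cospectral G H ↔ (G.adjMatrix ℤ).charpoly = (H.adjMatrix ℤ).charpoly := by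
  unfold Cospectral
  convert Iff.rfl

variable {V : Type*} [Fintype V] [DecidableEq V]

/-- `P` is `k` times an orthogonal matrix that fixes the all-one vector and conjugates the adjacency
matrix of `G` to that of `H`. -/
structure IsSpectralSimilarity (P : Matrix V V ℤ) (k : ℤ) (G H : SimpleGraph V)
    [DecidableRel G.Adj] [DecidableRel H.Adj] : Prop where
  ne_zero : k ≠ 0
  transpose_mul_self : Pᵀ * P = k ^ 2 • 1
  mulVec_one : P *ᵥ 1 = k • 1
  mul_adjMatrix : P * G.adjMatrix ℤ = H.adjMatrix ℤ * P

/-- A spectral similarity that fixes the indicator of the vertex `s`. -/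
structure IsRootedSimilarity (P : Matrix V V ℤ) (k : ℤ) (G H : SimpleGraph V) (s : V)
    [DecidableRel G.Adj] [DecidableRel H.Adj] : Prop extends IsSpectralSimilarity P k G H where
  mulVec_single : P *ᵥ Pi.single s 1 = k • Pi.single s 1

namespace IsSpectralSimilarity

variable {P : Matrix V V ℤ} {k : ℤ} {G H : SimpleGraph V} [DecidableRel G.Adj]
  [DecidableRel H.Adj]

theorem det_ne_zero (h : IsSpectralSimilarity P k G H) : P.det ≠ 0 := by
  intro hdet
  have hmul := congrArg det h.transpose_mul_self
  rw [det_mul, hdet, mul_zero, det_smul, det_one, mul_one] at hmul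
  exact pow_ne_zero _ (pow_ne_zero _ h.ne_zero) hmul.symm

theorem vecMul_eq (h : IsSpectralSimilarity P k G H) {x : V → ℤ} (hx : P *ᵥ x = k • x) :
    x ᵥ* P = k • x := by
  have hmul := congrArg (Pᵀ *ᵥ ·) hx
  simp only [mulVec_mulVec, h.transpose_mul_self, smul_mulVec, one_mulVec, mulVec_smul,
    mulVec_transpose, pow_two, mul_smul] at hmul
  exact (smul_right_injective _ h.ne_zero hmul).symm

theorem mul_adjMatrix_compl (h : IsSpectralSimilarity P k G H) :
    P * Gᶜ.adjMatrix ℤ = Hᶜ.adjMatrix ℤ * P := by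
  have hcompl (K : SimpleGraph V) [DecidableRel K.Adj] :
      Kᶜ.adjMatrix ℤ = of 1 - (1 + K.adjMatrix ℤ) := by
    rw [← K.compl_adjMatrix_eq_adjMatrix_compl ℤ, eq_sub_iff_add_eq',
      K.one_add_adjMatrix_add_compl_adjMatrix_eq_of_one ℤ]
  have hones : P * of 1 = of 1 * P := by
    ext i j
    have hrow := congrFun h.mulVec_one i
    have hcol := congrFun (h.vecMul_eq h.mulVec_one) j
    simp only [mulVec, vecMul, Pi.smul_apply, Pi.one_apply] at hrow hcol
    exact hrow.trans hcol.symm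
  rw [hcompl, hcompl, mul_sub, sub_mul, mul_add, add_mul, mul_one, one_mul, h.mul_adjMatrix, hones]

theorem cospectral (h : IsSpectralSimilarity P k G H) : Cospectral G H :=
  cospectral_iff.2 (charpoly_eq_of_mul_eq_mul h.det_ne_zero h.mul_adjMatrix)

theorem cospectral_compl (h : IsSpectralSimilarity P k G H) : Cospectral Gᶜ Hᶜ :=
  cospectral_iff.2 (charpoly_eq_of_mul_eq_mul h.det_ne_zero h.mul_adjMatrix_compl)

end IsSpectralSimilarity

section Extension

open coalescence

variable {W : Type*} [Fintype W] [DecidableEq W] {P : Matrix W W ℤ} {k : ℤ} {s : W}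

variable (V) in
/-- The extension of a matrix on the vertices of `H` to the vertices of a coalescence that acts on
the vertices of the first graph by the scalar `k`. -/
def coalescenceMatrix (P : Matrix W W ℤ) (k : ℤ) (s : W) :
    Matrix (V ⊕ {w : W // w ≠ s}) (V ⊕ {w : W // w ≠ s}) ℤ :=
  fromBlocks (k • 1) 0 0 (P.submatrix Subtype.val Subtype.val)

omit [Fintype V] [Fintype W] [DecidableEq W] in
theorem coalescenceMatrix_transpose :
    (coalescenceMatrix V P k s)ᵀ = coalescenceMatrix V Pᵀ k s := by
  simp only [coalescenceMatrix, fromBlocks_transpose, transpose_smul, transpose_one,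
    transpose_zero, transpose_submatrix]

theorem coalescenceMatrix_mulVec_comp_inl (z : V ⊕ {w : W // w ≠ s} → ℤ) :
    (coalescenceMatrix V P k s *ᵥ z) ∘ .inl = k • (z ∘ .inl) := by
  simp only [coalescenceMatrix, fromBlocks_mulVec, zero_mulVec, add_zero, smul_mulVec,
    one_mulVec, Sum.elim_comp_inl]

omit [DecidableEq V] [Fintype V] in
theorem mulVec_apply_eq_mul (hrow : Pi.single s 1 ᵥ* P = k • Pi.single s 1) (y : W → ℤ) :
    (P *ᵥ y) s = k * y s := by
  rw [← single_one_dotProduct s (P *ᵥ y), dotProduct_mulVec, hrow, smul_dotProduct,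
    single_one_dotProduct, smul_eq_mul]

theorem coalescenceMatrix_mulVec_comp_inr {r : V} (hcol : P *ᵥ Pi.single s 1 = k • Pi.single s 1)
    (hrow : Pi.single s 1 ᵥ* P = k • Pi.single s 1) (z : V ⊕ {w : W // w ≠ s} → ℤ) :
    (coalescenceMatrix V P k s *ᵥ z) ∘ inr r s = P *ᵥ (z ∘ inr r s) := by
  funext w
  rw [Function.comp_apply]
  obtain rfl | hw := eq_or_ne w s
  · rw [inr_root, mulVec_apply_eq_mul hrow, Function.comp_apply, inr_root]
    exact congrFun (coalescenceMatrix_mulVec_comp_inl z) r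
  · have hentry : P w s = 0 := by
      simpa [hw] using congrFun hcol w
    rw [inr_coe ⟨w, hw⟩, mulVec, mulVec, dotProduct, dotProduct, Fintype.sum_sum_type,
      Fintype.sum_eq_add_sum_subtype_ne _ s, hentry]
    simp [coalescenceMatrix]

variable {τ : SimpleGraph V} {r : V} {H H' : SimpleGraph W} [DecidableRel H.Adj]
  [DecidableRel H'.Adj]

/-- The two graphs of a coalescence interact only through the root, which `P` fixes up to the same
scalar by which the extension acts on `τ`. -/
theorem IsRootedSimilarity.coalescence [DecidableRel (coalescence τ r H s).Adj]
    [DecidableRel (coalescence τ r H' s).Adj] (h : IsRootedSimilarity P k H H' s) :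
    IsSpectralSimilarity (coalescenceMatrix V P k s) k (coalescence τ r H s)
      (coalescence τ r H' s) where
  ne_zero := h.ne_zero
  transpose_mul_self := by
    have hrow := h.vecMul_eq h.mulVec_single
    refine ext_iff_mulVec.2 fun z => eq_of_comp_inl_of_comp_inr (r := r) ?_ ?_
    · rw [← mulVec_mulVec, coalescenceMatrix_transpose, coalescenceMatrix_mulVec_comp_inl,
        coalescenceMatrix_mulVec_comp_inl, smul_smul, ← pow_two, smul_mulVec, one_mulVec]
      rfl
    · rw [← mulVec_mulVec, coalescenceMatrix_transpose, coalescenceMatrix_mulVec_comp_inr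
        (by rwa [mulVec_transpose]) (by rw [vecMul_transpose, h.mulVec_single]),
        coalescenceMatrix_mulVec_comp_inr h.mulVec_single hrow, mulVec_mulVec,
        h.transpose_mul_self, smul_mulVec, one_mulVec, smul_mulVec, one_mulVec]
      rfl
  mulVec_one := by
    refine eq_of_comp_inl_of_comp_inr (r := r) (coalescenceMatrix_mulVec_comp_inl 1) ?_
    rw [coalescenceMatrix_mulVec_comp_inr h.mulVec_single (h.vecMul_eq h.mulVec_single)]
    exact h.mulVec_one
  mul_adjMatrix := by
    classical
    have hrow := h.vecMul_eq h.mulVec_single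
    refine ext_iff_mulVec.2 fun z => eq_of_comp_inl_of_comp_inr (r := r) ?_ ?_
    · rw [← mulVec_mulVec, ← mulVec_mulVec, coalescenceMatrix_mulVec_comp_inl,
        adjMatrix_mulVec_comp_inl, adjMatrix_mulVec_comp_inl, coalescenceMatrix_mulVec_comp_inl,
        coalescenceMatrix_mulVec_comp_inr h.mulVec_single hrow, mulVec_mulVec, ← h.mul_adjMatrix,
        ← mulVec_mulVec, mulVec_smul, smul_add, smul_smul,
        mulVec_apply_eq_mul hrow]
    · rw [← mulVec_mulVec, ← mulVec_mulVec,
        coalescenceMatrix_mulVec_comp_inr h.mulVec_single hrow, adjMatrix_mulVec_comp_inr,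
        adjMatrix_mulVec_comp_inr, coalescenceMatrix_mulVec_comp_inl,
        coalescenceMatrix_mulVec_comp_inr h.mulVec_single hrow, mulVec_add, mulVec_mulVec,
        mulVec_mulVec, h.mul_adjMatrix, mulVec_smul, mulVec_smul, h.mulVec_single, Pi.smul_apply,
        smul_comm, smul_assoc]

end Extension

end Similarity

section Godsil

open PowerSeries Matrix

theorem connected_of_iterate_eq {V : Type*} {G : SimpleGraph V} {r : V} {parent : V → V}
    (hadj : ∀ v ≠ r, G.Adj v (parent v)) (hroot : ∀ v, ∃ k, parent^[k] v = r) :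
    G.Connected := by
  have hreach (k : ℕ) : ∀ v, parent^[k] v = r → G.Reachable v r := by
    induction k with
    | zero => exact fun v hv => hv ▸ SimpleGraph.Reachable.refl v
    | succ k ih =>
      intro v hv
      rcases eq_or_ne v r with rfl | hne
      · exact SimpleGraph.Reachable.refl v
      · exact (hadj v hne).reachable.trans (ih (parent v) hv)
  exact (SimpleGraph.connected_iff_exists_forall_reachable G).2
    ⟨r, fun v => (hroot v).elim fun k hk => (hreach k v hk).symm⟩

instance : DecidableRel godsilS₁.Adj :=
  inferInstanceAs (DecidableRel (SimpleGraph.fromEdgeSet _).Adj)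

instance : DecidableRel godsilS₂.Adj :=
  inferInstanceAs (DecidableRel (SimpleGraph.fromEdgeSet _).Adj)

theorem isTree_godsilS₁ : godsilS₁.IsTree := by
  have hcard : godsilS₁.edgeFinset.card = 10 := by decide +kernel
  refine SimpleGraph.isTree_iff_connected_and_card.2
    ⟨connected_of_iterate_eq (r := 0) (parent := ![0, 0, 0, 1, 2, 2, 3, 10, 7, 7, 5])
      (by decide) fun v => ⟨5, ?_⟩, ?_⟩
  · decide +revert
  · rw [Nat.card_eq_fintype_card, ← SimpleGraph.edgeFinset_card, hcard, Nat.card_fin]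

theorem isTree_godsilS₂ : godsilS₂.IsTree := by
  have hcard : godsilS₂.edgeFinset.card = 10 := by decide +kernel
  refine SimpleGraph.isTree_iff_connected_and_card.2
    ⟨connected_of_iterate_eq (r := 0) (parent := ![0, 10, 0, 1, 1, 2, 2, 3, 7, 8, 0])
      (by decide) fun v => ⟨6, ?_⟩, ?_⟩
  · decide +revert
  · rw [Nat.card_eq_fintype_card, ← SimpleGraph.edgeFinset_card, hcard, Nat.card_fin]

/-- Seven times an orthogonal matrix that conjugates the adjacency matrices of Godsil's trees. -/
def godsilMatrix : Matrix (Fin 11) (Fin 11) ℤ :=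
  !![7, 0, 0, 0, 0, 0, 0, 0, 0, 0, 0;
    0, -2, 2, 1, 3, 3, -2, 4, -1, -1, 0;
    0, 3, 4, 2, -1, -1, 3, 1, -2, -2, 0;
    0, 0, 0, 0, 0, 0, 0, 0, 0, 0, 7;
    0, -3, 3, -2, 1, 1, 4, -1, 2, 2, 0;
    0, 1, -1, 3, 2, 2, 1, -2, 4, -3, 0;
    0, 1, -1, 3, 2, 2, 1, -2, -3, 4, 0;
    0, 2, -2, -1, -3, 4, 2, 3, 1, 1, 0;
    0, -1, 1, 4, -2, -2, -1, 2, 3, 3, 0;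
    0, 2, -2, -1, 4, -3, 2, 3, 1, 1, 0;
    0, 4, 3, -2, 1, 1, -3, -1, 2, 2, 0]

theorem isRootedSimilarity_godsilMatrix :
    IsRootedSimilarity godsilMatrix 7 godsilS₁ godsilS₂ 0 where
  ne_zero := by decide
  transpose_mul_self := by decide +kernel
  mulVec_one := by decide +kernel
  mul_adjMatrix := by decide +kernel
  mulVec_single := by decide +kernel

theorem X_pow_dvd_growthSum_godsilS₁_sub : X ^ 8 ∣ growthSum godsilS₁ - growthSum godsilS₂ := by
  have hcoeff : ∀ k < 8, ∑ v, growthSolution godsilS₁ 1 k v =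
      ∑ v, growthSolution godsilS₂ 1 k v := by
    decide +kernel
  refine X_pow_dvd_iff.2 fun k hk => ?_
  rw [map_sub, coeff_growthSum, coeff_growthSum, hcoeff k hk, sub_self]

theorem coeff_inv_mulVec_one_godsilS₁_sub {k : ℕ} (hk : k ≤ 6) :
    coeff k (((growthMatrix godsilS₁)⁻¹ *ᵥ 1) 0 - ((growthMatrix godsilS₂)⁻¹ *ᵥ 1) 0) =
      if k = 6 then -1 else 0 := by
  have hcoeff : ∀ k ≤ 6, growthSolution godsilS₁ 1 k 0 - growthSolution godsilS₂ 1 k 0 =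
      if k = 6 then -1 else 0 := by
    decide +kernel
  rw [map_sub, coeff_growthMatrix_inv_mulVec_one, coeff_growthMatrix_inv_mulVec_one, hcoeff k hk]

theorem X_pow_dvd_inv_godsilS₁_sub :
    X ^ 6 ∣ (growthMatrix godsilS₁)⁻¹ 0 0 - (growthMatrix godsilS₂)⁻¹ 0 0 := by
  have hcoeff : ∀ k < 6, growthSolution godsilS₁ (Pi.single 0 1) k 0 =
      growthSolution godsilS₂ (Pi.single 0 1) k 0 := by
    decide +kernel
  refine X_pow_dvd_iff.2 fun k hk => ?_
  rw [map_sub, coeff_growthMatrix_inv_apply, coeff_growthMatrix_inv_apply, hcoeff k hk, sub_self]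

variable {V : Type*} [Finite V] {τ : SimpleGraph V} {r : V}

theorem geodesicGrowthSeries_coalescence_godsil_ne (hτ : τ.CliqueFree 3) (hr : ∃ v, τ.Adj r v) :
    geodesicGrowthSeries (coalescence τ r godsilS₁ 0) ≠
      geodesicGrowthSeries (coalescence τ r godsilS₂ 0) := by
  classical
  have := Fintype.ofFinite V
  have hdegree : 0 < τ.degree r := (τ.degree_pos_iff_exists_adj r).2 hr
  have hne := growthSum_coalescence_ne (k := 6) hdegree X_pow_dvd_growthSum_godsilS₁_sub
    (X_pow_dvd_iff.2 fun k hk => by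
      rw [coeff_inv_mulVec_one_godsilS₁_sub hk.le, if_neg hk.ne])
    (by rw [coeff_inv_mulVec_one_godsilS₁_sub le_rfl]; decide) X_pow_dvd_inv_godsilS₁_sub
  exact fun heq => hne <| growthSum_eq_of_geodesicGrowthSeries_eq
    (coalescence.cliqueFree_three hτ (isTree_godsilS₁.isAcyclic.cliqueFree le_rfl))
    (coalescence.cliqueFree_three hτ (isTree_godsilS₂.isAcyclic.cliqueFree le_rfl)) rfl heq

end Godsil

section Iso

variable {V W : Type*} {G : SimpleGraph V} {H : SimpleGraph W}

theorem movesToFront_map_iff (e : G ≃g H) {a : V} {w : List V} :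
    MovesToFront H (e a) (w.map e) ↔ MovesToFront G a w := by
  induction w with
  | nil => rfl
  | cons c w ih => simp only [List.map_cons, MovesToFront, ih, e.map_adj_iff, e.injective.eq_iff]

theorem isTraceReduced_map_iff (e : G ≃g H) {w : List V} :
    IsTraceReduced H (w.map e) ↔ IsTraceReduced G w := by
  induction w with
  | nil => rfl
  | cons c w ih => simp only [List.map_cons, IsTraceReduced, ih, movesToFront_map_iff]

theorem geodesicGrowthSeries_congr (e : G ≃g H) :
    geodesicGrowthSeries G = geodesicGrowthSeries H := by
  ext m
  simp only [geodesicGrowthSeries, PowerSeries.coeff_mk, geodesicGrowth, isGeodesicWord_iff]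
  refine Set.ncard_congr (fun w _ => w.map e) ?_ ?_ ?_
  · rintro w ⟨hlength, hw⟩
    exact ⟨by rwa [List.length_map], (isTraceReduced_map_iff e).2 hw⟩
  · exact fun _ _ _ _ h => e.injective.list_map h
  · rintro w ⟨hlength, hw⟩
    have hmap : (w.map e.symm).map e = w := by simp [Function.comp_def]
    refine ⟨w.map e.symm, ⟨by rwa [List.length_map], ?_⟩, hmap⟩
    rwa [← isTraceReduced_map_iff e, hmap]

theorem cospectral_of_iso [Fintype V] [Fintype W] (e : G ≃g H) : Cospectral G H := by
  classical
  rw [cospectral_iff, ← e.reindex_adjMatrix ℤ]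
  exact (Matrix.charpoly_reindex e.toEquiv _).symm

/-- The isomorphism of complements induced by an isomorphism of graphs. -/
def complIso (e : G ≃g H) : Gᶜ ≃g Hᶜ where
  toEquiv := e.toEquiv
  map_rel_iff' := and_congr e.injective.ne_iff (not_congr e.map_adj_iff)

end Iso

theorem theorem2_general {V : Type*} [Fintype V] {τ : SimpleGraph V} {r : V}
    (hτ : τ.CliqueFree 3) (hr : ∃ v, τ.Adj r v) :
    IsEmpty (coalescence τ r godsilS₁ 0 ≃g coalescence τ r godsilS₂ 0) ∧
      Cospectral (coalescence τ r godsilS₁ 0) (coalescence τ r godsilS₂ 0) ∧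
      Cospectral (coalescence τ r godsilS₁ 0)ᶜ (coalescence τ r godsilS₂ 0)ᶜ ∧
      geodesicGrowthSeries (coalescence τ r godsilS₁ 0) ≠
        geodesicGrowthSeries (coalescence τ r godsilS₂ 0) := by
  classical
  have hsimilarity := isRootedSimilarity_godsilMatrix.coalescence (τ := τ) (r := r)
  have hne := geodesicGrowthSeries_coalescence_godsil_ne hτ hr
  exact ⟨⟨fun e => hne (geodesicGrowthSeries_congr e)⟩, hsimilarity.cospectral,
    hsimilarity.cospectral_compl, hne⟩

theorem coalescence_godsil_of_isTree {V : Type*} [Fintype V] {τ : SimpleGraph V} {r : V}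
    (hτ : τ.IsTree) (hcard : 2 ≤ Fintype.card V) :
    (coalescence τ r godsilS₁ 0).IsTree ∧ (coalescence τ r godsilS₂ 0).IsTree ∧
      IsEmpty (coalescence τ r godsilS₁ 0 ≃g coalescence τ r godsilS₂ 0) ∧
      Cospectral (coalescence τ r godsilS₁ 0) (coalescence τ r godsilS₂ 0) ∧
      Cospectral (coalescence τ r godsilS₁ 0)ᶜ (coalescence τ r godsilS₂ 0)ᶜ ∧
      geodesicGrowthSeries (coalescence τ r godsilS₁ 0) ≠
        geodesicGrowthSeries (coalescence τ r godsilS₂ 0) := by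
  have := Fintype.one_lt_card_iff_nontrivial.1 hcard
  exact ⟨coalescence.isTree hτ isTree_godsilS₁, coalescence.isTree hτ isTree_godsilS₂,
    theorem2_general (hτ.isAcyclic.cliqueFree le_rfl)
      (hτ.connected.preconnected.exists_adj_of_nontrivial r)⟩

theorem exists_fin_of_card_eq {V : Type*} [Fintype V] {G H : SimpleGraph V} {n : ℕ}
    (hn : Fintype.card V = n) (hG : G.IsTree) (hH : H.IsTree) (hiso : IsEmpty (G ≃g H))
    (hcospectral : Cospectral G H) (hcompl : Cospectral Gᶜ Hᶜ)
    (hseries : geodesicGrowthSeries G ≠ geodesicGrowthSeries H) :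
    ∃ T₁ T₂ : SimpleGraph (Fin n), T₁.IsTree ∧ T₂.IsTree ∧ IsEmpty (T₁ ≃g T₂) ∧
      Cospectral T₁ T₂ ∧ Cospectral T₁ᶜ T₂ᶜ ∧
      geodesicGrowthSeries T₁ ≠ geodesicGrowthSeries T₂ := by
  let e₁ := SimpleGraph.overFinIso G hn
  let e₂ := SimpleGraph.overFinIso H hn
  refine ⟨G.overFin hn, H.overFin hn, e₁.isTree_iff.1 hG, e₂.isTree_iff.1 hH,
    ⟨fun e => hiso.false ((e₁.trans e).trans e₂.symm)⟩,
    (cospectral_of_iso e₁).symm.trans (hcospectral.trans (cospectral_of_iso e₂)),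
    (cospectral_of_iso (complIso e₁)).symm.trans
      (hcompl.trans (cospectral_of_iso (complIso e₂))), ?_⟩
  rwa [← geodesicGrowthSeries_congr e₁, ← geodesicGrowthSeries_congr e₂]

theorem card_coalescence_godsil {V : Type*} [Fintype V] :
    Fintype.card (V ⊕ {w : Fin 11 // w ≠ 0}) = Fintype.card V + 10 := by
  have hcard := coalescence.card_add_one (V := V) (s := (0 : Fin 11))
  rw [Fintype.card_fin] at hcard
  omega

theorem theorem2 (n : ℕ) (hn : 12 ≤ n) :
    (∀ (V : Type*) [Fintype V] (τ : SimpleGraph V) (r : V),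
      τ.IsTree → Fintype.card V + 10 = n →
        (coalescence τ r godsilS₁ 0).IsTree ∧
        (coalescence τ r godsilS₂ 0).IsTree ∧
        Fintype.card (V ⊕ {w : Fin 11 // w ≠ 0}) = n ∧
        IsEmpty (coalescence τ r godsilS₁ 0 ≃g coalescence τ r godsilS₂ 0) ∧
        Cospectral (coalescence τ r godsilS₁ 0) (coalescence τ r godsilS₂ 0) ∧
        Cospectral (coalescence τ r godsilS₁ 0)ᶜ (coalescence τ r godsilS₂ 0)ᶜ ∧
        geodesicGrowthSeries (coalescence τ r godsilS₁ 0) ≠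
          geodesicGrowthSeries (coalescence τ r godsilS₂ 0)) ∧
    (∃ T₁ T₂ : SimpleGraph (Fin n),
      T₁.IsTree ∧ T₂.IsTree ∧ IsEmpty (T₁ ≃g T₂) ∧
        Cospectral T₁ T₂ ∧ Cospectral T₁ᶜ T₂ᶜ ∧
        geodesicGrowthSeries T₁ ≠ geodesicGrowthSeries T₂) := by
  constructor
  · intro V _ τ r hτ hV
    obtain ⟨htree₁, htree₂, hspec⟩ := coalescence_godsil_of_isTree (r := r) hτ (by omega)
    exact ⟨htree₁, htree₂, card_coalescence_godsil.trans hV, hspec⟩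
  · obtain ⟨m, rfl⟩ : ∃ m, n = m + 2 + 10 := ⟨n - 12, by omega⟩
    obtain ⟨htree₁, htree₂, hiso, hcospectral, hcompl, hseries⟩ :=
      coalescence_godsil_of_isTree (r := 0) (SimpleGraph.isTree_starGraph (0 : Fin (m + 2)))
        (by rw [Fintype.card_fin]; omega)
    exact exists_fin_of_card_eq (by rw [card_coalescence_godsil, Fintype.card_fin])
      htree₁ htree₂ hiso hcospectral hcompl hseries
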